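/- Let $p$ be a prime, $k$ a field of characteristic $p$, and $A=k[x_1,\dots,x_n]$ ($n\ge 0$) the polynomial ring, graded by $\deg(x_i)=-1$. A $p$-DG $A$-module is a $\mathbb Z$-graded $A$-module $M$ with an $A$-linear map $d\colon M\to M$ of degree $-1$ such that $d^p=0$; it is called free if its underlying graded $A$-module is a direct sum of shifts of $A$, and finitely generated if its underlying $A$-module is. For a ring $R$ and an $R$-module $P$ with an $R$-linear map $d\colon P\to P$ such that $d^p=0$ (a $p$-differential $R$-module), put ${}_sH(P)=\ker(d^s)/\operatorname{im}(d^{p-s})$ for $1\le s\le p-1$, and call $P$ contractible if it is isomorphic, as an $R$-module with differential, to a direct sum $C\oplus\dots\oplus C$ of $p$ copies of some $R$-module $C$ with differential $(c_1,\dots,c_p)\mapsto(c_2,\dots,c_p,0)$. Let $M$ be a finitely generated free $p$-DG $A$-module such that $\dim_k {}_sH(M)<\infty$ for all $1\le s\le p-1$, and let $\mathfrak m\ne(x_1,\dots,x_n)$ be a maximal ideal of $A$, not necessarily homogeneous. Equip $M\otimes_A A/\mathfrak m$ and $M\otimes_A A_{\mathfrak m}$ with the differentials induced by $d$. Then $${}_sH(M\otimes_A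 A/\mathfrak m)=0\quad\text{for all } 1\le s\le p-1,$$ and the $p$-differential $A_{\mathfrak m}$-module $M\otimes_A A_{\mathfrak m}$ is contractible. -/

import Mathlib

open scoped TensorProduct

universe u v

/-- The degree `i` part of `k[x₁, …, xₙ]`, graded over `ℤ` by `deg xⱼ = -1`. -/
noncomputable def polyGrading (k : Type u) [Field k] (n : ℕ) (i : ℤ) :
    Submodule k (MvPolynomial (Fin n) k) :=
  MvPolynomial.weightedHomogeneousSubmodule k (fun _ : Fin n => (-1 : ℤ)) i

/-- A `p`-differential graded module over `A = k[x₁, …, xₙ]` with underlying ungraded `A`-module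
`M`: a `ℤ`-grading `gr` of `M` making it a graded `A`-module, and an `A`-linear map `d` of
degree `-1` with `d ^ p = 0`. -/
structure PDGModule (k : Type u) [Field k] (n p : ℕ) (M : Type v) [AddCommGroup M] [Module k M]
    [Module (MvPolynomial (Fin n) k) M] [IsScalarTower k (MvPolynomial (Fin n) k) M] where
  gr : ℤ → Submodule k M
  isInternal : DirectSum.IsInternal gr
  smul_mem : ∀ (i j : ℤ) (a : MvPolynomial (Fin n) k) (x : M),
    a ∈ polyGrading k n i → x ∈ gr j → a • x ∈ gr (i + j)
  d : M →ₗ[MvPolynomial (Fin n) k] M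
  d_mem : ∀ (i : ℤ) (x : M), x ∈ gr i → d x ∈ gr (i - 1)
  d_pow : d ^ p = 0

/-- A `p`-DG module is free if its underlying graded module is a direct sum of shifts of `A`,
that is, if it has an `A`-basis consisting of homogeneous elements. -/
def PDGModule.IsFree {k : Type u} [Field k] {n p : ℕ} {M : Type v} [AddCommGroup M] [Module k M]
    [Module (MvPolynomial (Fin n) k) M] [IsScalarTower k (MvPolynomial (Fin n) k) M]
    (D : PDGModule k n p M) : Prop :=
  ∃ (ι : Type v) (b : Module.Basis ι (MvPolynomial (Fin n) k) M) (c : ι → ℤ),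
    ∀ i, b i ∈ D.gr (c i)

/-- The homology `ₛH(P) = ker dˢ / im dᴺ⁻ˢ` of an `N`-differential module `(P, d)`, for
`1 ≤ s ≤ N - 1` and `d ^ N = 0`. (For a `p`-DG module this is the total homology, the direct sum of
all the homogeneous parts of the graded module `ₛH_•`.) -/
abbrev NHomology {R : Type u} [Ring R] {P : Type v} [AddCommGroup P] [Module R P]
    (N s : ℕ) (d : P →ₗ[R] P) : Type v :=
  LinearMap.ker (d ^ s) ⧸ (LinearMap.range (d ^ (N - s))).submoduleOf (LinearMap.ker (d ^ s))

/-- An `N`-differential module `(P, d)` is contractible if it is isomorphic to a direct sum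
`C ⊕ ⋯ ⊕ C` of `N` copies of a module `C`, with the differential
`(c₁, …, c_N) ↦ (c₂, …, c_N, 0)`. -/
def IsContractibleNDifferential {R : Type u} [Ring R] {P : Type v} [AddCommGroup P] [Module R P]
    (N : ℕ) (d : P →ₗ[R] P) : Prop :=
  ∃ (C : Type v) (_ : AddCommGroup C) (_ : Module R C) (e : P ≃ₗ[R] (Fin N → C)),
    ∀ (x : P) (i : Fin N), e (d x) i = if h : (i : ℕ) + 1 < N then e x ⟨i + 1, h⟩ else 0

/-! Some variable `X j` lies outside `m`. It acts on each finite-dimensional graded homology space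
with nonzero degree, hence nilpotently (`exists_pow_mem_range_of_finiteDimensional`), so homology
dies after localizing at `m`.

Over the localization, `d` and `d ^ (p - 1)` then alternate in an exact 2-periodic complex of
projectives. The global dimension is finite (Hilbert's syzygy theorem), and `ker d` is an
arbitrarily high syzygy of the complex, so it is projective (`projective_ker_of_exact`). Hence `d ^
(p - 1)`, as a surjection onto `ker d`, has a section, and this section splits the module into `p`
shifted copies of `ker d`.

A contractible module carries a linear homotopy `x = d ^ (p - s) (a x) + b (d ^ s x)`. Reducing it
modulo `m` gives the vanishing over the residue field. -/

/-! ### Projective and global dimension under base change -/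

open CategoryTheory in
theorem hasProjectiveDimensionLE_of_exact {R : Type u} [Ring R] {L M N : Type v}
    [AddCommGroup L] [Module R L] [AddCommGroup M] [Module R M] [AddCommGroup N] [Module R N]
    {f : L →ₗ[R] M} {g : M →ₗ[R] N} (hf : Function.Injective f) (hfg : Function.Exact f g)
    (hg : Function.Surjective g) {n : ℕ} (hL : HasProjectiveDimensionLE (ModuleCat.of R L) n)
    (hM : HasProjectiveDimensionLE (ModuleCat.of R M) (n + 1)) :
    HasProjectiveDimensionLE (ModuleCat.of R N) (n + 1) :=
  (ModuleCat.shortComplex_shortExact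
    (ShortComplex.mk (ModuleCat.ofHom f) (ModuleCat.ofHom g)
      (by ext x; exact hfg.apply_apply_eq_zero x)) hfg hf hg).hasProjectiveDimensionLT_X₃
    (n + 1) hL hM

open CategoryTheory in
theorem hasProjectiveDimensionLE_ker {R : Type u} [Ring R] [Small.{v} R] {M N : Type v}
    [AddCommGroup M] [Module R M] [AddCommGroup N] [Module R N] [Module.Projective R M]
    {g : M →ₗ[R] N} (hg : Function.Surjective g) {n : ℕ}
    (hN : HasProjectiveDimensionLE (ModuleCat.of R N) (n + 1)) :
    HasProjectiveDimensionLE (ModuleCat.of R (LinearMap.ker g)) n := by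
  have hM : Projective (ModuleCat.of R M) := (IsProjective.iff_projective M).mp ‹_›
  exact ((LinearMap.shortExact_shortComplexKer hg).hasProjectiveDimensionLT_X₃_iff n hM).mp hN

open CategoryTheory in
theorem hasProjectiveDimensionLE_zero_iff {R : Type u} [Ring R] [Small.{v} R] {M : Type v}
    [AddCommGroup M] [Module R M] :
    HasProjectiveDimensionLE (ModuleCat.of R M) 0 ↔ Module.Projective R M := by
  rw [← projective_iff_hasProjectiveDimensionLE_zero, IsProjective.iff_projective]

open CategoryTheory in
theorem hasProjectiveDimensionLE_congr {R : Type u} [Ring R] [Small.{v} R] {M N : Type v}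
    [AddCommGroup M] [Module R M] [AddCommGroup N] [Module R N] (e : M ≃ₗ[R] N) {n : ℕ}
    (h : HasProjectiveDimensionLE (ModuleCat.of R M) n) :
    HasProjectiveDimensionLE (ModuleCat.of R N) n :=
  hasProjectiveDimensionLT_of_iso e.toModuleIso (n + 1)

/-- Flat base change does not increase the projective dimension. -/
theorem hasProjectiveDimensionLE_baseChange {R S : Type u} [CommRing R] [CommRing S] [Algebra R S]
    [Module.Flat R S] {M : Type (max u v)} [AddCommGroup M] [Module R M] {n : ℕ}
    (h : CategoryTheory.HasProjectiveDimensionLE (ModuleCat.of R M) n) :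
    CategoryTheory.HasProjectiveDimensionLE (ModuleCat.of S (S ⊗[R] M)) n := by
  induction n generalizing M with
  | zero =>
    rw [hasProjectiveDimensionLE_zero_iff] at h ⊢
    infer_instance
  | succ n ih =>
    obtain ⟨P, _, _, _, g, hg⟩ : ∃ (P : Type (max u v)) (_ : AddCommGroup P) (_ : Module R P)
        (_ : Module.Projective R P) (g : P →ₗ[R] M), Function.Surjective g :=
      ⟨M →₀ R, inferInstance, inferInstance, inferInstance, Finsupp.linearCombination R id,
        Finsupp.linearCombination_id_surjective R M⟩
    refine hasProjectiveDimensionLE_of_exact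
      (f := (LinearMap.ker g).subtype.baseChange S) (g := g.baseChange S) ?_ ?_ ?_
      (ih (hasProjectiveDimensionLE_ker hg h)) ?_
    · exact Module.Flat.lTensor_preserves_injective_linearMap _ Subtype.val_injective
    · exact lTensor_exact S (LinearMap.exact_subtype_ker_map g) hg
    · exact LinearMap.lTensor_surjective S hg
    · have := (hasProjectiveDimensionLE_zero_iff (R := S) (M := S ⊗[R] P)).mpr inferInstance
      exact CategoryTheory.hasProjectiveDimensionLT_of_ge _ 1 _ (by omega)

/-- The global dimension of `R` (tested on modules in the given universe) is at most `n`. -/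
def GlobalDimensionLE (R : Type u) [Ring R] (n : ℕ) : Prop :=
  ∀ (M : Type (max u v)) [AddCommGroup M] [Module R M],
    CategoryTheory.HasProjectiveDimensionLE (ModuleCat.of R M) n

/-- An `S`-module is recovered from its restriction to `R` by the flat base change to `S`. -/
theorem GlobalDimensionLE.isLocalization {R S : Type u} [CommRing R] [CommRing S] [Algebra R S]
    (W : Submonoid R) [IsLocalization W S] {n : ℕ} (h : GlobalDimensionLE.{u, v} R n) :
    GlobalDimensionLE.{u, v} S n := by
  intro M _ _
  let _ : Module R M := Module.compHom M (algebraMap R S)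
  have : IsScalarTower R S M := .of_algebraMap_smul fun _ _ => rfl
  have : Module.Flat R S := IsLocalization.flat S W
  exact hasProjectiveDimensionLE_congr (IsLocalization.moduleLid W S M)
    (hasProjectiveDimensionLE_baseChange.{u, v} (S := S) (h M))

theorem GlobalDimensionLE.of_ringEquiv {R S : Type u} [CommRing R] [CommRing S] (e : R ≃+* S)
    {n : ℕ} (h : GlobalDimensionLE.{u, v} R n) : GlobalDimensionLE.{u, v} S n := by
  let _ : Algebra R S := e.toRingHom.toAlgebra
  have : IsLocalization (⊥ : Submonoid R) R := IsLocalization.self bot_le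
  have : IsLocalization (⊥ : Submonoid R) S :=
    IsLocalization.isLocalization_of_algEquiv ⊥ (AlgEquiv.ofRingEquiv (f := e) fun _ => rfl)
  exact h.isLocalization ⊥

/-! ### The exact sequence `0 → R[X] ⊗ N → R[X] ⊗ N → N → 0` -/

section Polynomial

open Polynomial

variable {R : Type*} [CommRing R] {N : Type*} [AddCommGroup N] [Module R N] [Module R[X] N]
  [IsScalarTower R R[X] N]

/-- The endomorphism `X ⊗ 1 - 1 ⊗ X` of `R[X] ⊗ N`. -/
noncomputable def polynomialDiff (R : Type*) [CommRing R] (N : Type*) [AddCommGroup N] [Module R N]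
    [Module R[X] N] [IsScalarTower R R[X] N] : R[X] ⊗[R] N →ₗ[R[X]] R[X] ⊗[R] N :=
  (X : R[X]) • LinearMap.id - (Algebra.lsmul R R N (X : R[X])).baseChange R[X]

theorem polynomialDiff_tmul (q : R[X]) (y : N) :
    polynomialDiff R N (q ⊗ₜ y) = (X * q) ⊗ₜ y - q ⊗ₜ ((X : R[X]) • y) := by
  simp [polynomialDiff, TensorProduct.smul_tmul']

theorem liftBaseChange_id_tmul (q : R[X]) (y : N) :
    LinearMap.liftBaseChange R[X] (LinearMap.id : N →ₗ[R] N) (q ⊗ₜ y) = q • y := by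
  simp

/-- The coefficients of a kernel element satisfy `tᵢ = X • tᵢ₊₁`; since they vanish for large `i`,
they vanish downwards for all `i`. -/
theorem polynomialDiff_injective : Function.Injective (polynomialDiff R N) := by
  rw [injective_iff_map_eq_zero]
  intro t ht
  let e := PolynomialModule.polynomialTensorProductLEquivPolynomialModule R N
  let φ : N →ₗ[R] N := Algebra.lsmul R R N (X : R[X])
  have he (t : R[X] ⊗[R] N) : e (φ.baseChange R[X] t) = PolynomialModule.map R φ (e t) := by
    induction t with
    | zero => simp
    | add a b ha hb => simp [ha, hb]
    | tmul q y =>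
      have h1 (y : N) : e (q ⊗ₜ y) = q • PolynomialModule.single R 0 y := by
        simp [e, PolynomialModule.polynomialTensorProductLEquivPolynomialModule,
          PolynomialModule.lsingle, PolynomialModule.coeffLinearEquiv]
      rw [LinearMap.baseChange_tmul, h1, h1, PolynomialModule.map_smul, PolynomialModule.map_single]
      simp
  have hs (i : ℕ) : (e t).coeff i = φ ((e t).coeff (i + 1)) := by
    have h2 : (X : R[X]) • e t = PolynomialModule.map R φ (e t) := by
      rw [← he, ← map_smul, ← sub_eq_zero, ← map_sub]
      rw [show (X : R[X]) • t - φ.baseChange R[X] t = polynomialDiff R N t from rfl, ht, map_zero]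
    have h3 := congrArg (fun z => PolynomialModule.coeff z (i + 1)) h2
    rw [← monomial_one_one_eq_X] at h3
    simpa [PolynomialModule.map] using h3
  have hz (j i : ℕ) (h : (e t).coeff (i + j) = 0) : (e t).coeff i = 0 := by
    induction j with
    | zero => exact h
    | succ j ih => exact ih (by rw [hs, add_assoc, h, map_zero])
  obtain ⟨B, hB⟩ : ∃ B, ∀ i, B ≤ i → (e t).coeff i = 0 := by
    refine ⟨(e t).coeff.support.sup id + 1, fun i hi => ?_⟩
    by_contra h
    have := Finset.le_sup (f := id) (Finsupp.mem_support_iff.mpr h)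
    simp only [id] at this
    omega
  refine e.injective ?_
  rw [map_zero]
  ext i
  simpa using hz B i (hB _ (by omega))

/-- Modulo the image of `polynomialDiff`, powers of `X` move across the tensor sign, so each `t` is
congruent to `1 ⊗ y` with `y` its image in `N`. -/
theorem polynomialDiff_exact : Function.Exact (polynomialDiff R N)
    (LinearMap.liftBaseChange R[X] (LinearMap.id : N →ₗ[R] N)) := by
  have key (t : R[X] ⊗[R] N) : t - 1 ⊗ₜ (LinearMap.liftBaseChange R[X] (LinearMap.id : N →ₗ[R] N) t)
      ∈ LinearMap.range (polynomialDiff R N) := by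
    induction t with
    | zero => simp
    | add a b ha hb =>
      convert add_mem ha hb using 1
      rw [map_add, TensorProduct.tmul_add]
      abel
    | tmul q y =>
      rw [liftBaseChange_id_tmul]
      induction q using Polynomial.induction_on generalizing y with
      | C a =>
        rw [← mul_one (C a), ← smul_eq_C_mul, TensorProduct.smul_tmul, smul_assoc, one_smul,
          sub_self]
        exact zero_mem _
      | add q r hq hr =>
        convert add_mem (hq y) (hr y) using 1
        rw [TensorProduct.add_tmul, add_smul, TensorProduct.tmul_add]
        abel
      | monomial i a ih =>
        convert add_mem (LinearMap.mem_range_self (polynomialDiff R N) ((C a * X ^ i) ⊗ₜ y)) (ih ((X : R[X]) • y)) using 1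
        rw [polynomialDiff_tmul, smul_smul, pow_succ, ← mul_assoc, mul_comm X]
        abel
  intro t
  constructor
  · intro h
    simpa [h] using key t
  · rintro ⟨t, rfl⟩
    induction t with
    | zero => simp
    | add a b ha hb => rw [map_add, map_add, ha, hb, add_zero]
    | tmul q y =>
      rw [polynomialDiff_tmul, map_sub, liftBaseChange_id_tmul, liftBaseChange_id_tmul, smul_smul,
        mul_comm, sub_self]

end Polynomial

/-! ### Hilbert's syzygy theorem and periodic complexes -/

theorem GlobalDimensionLE.polynomial {R : Type u} [CommRing R] {n : ℕ}
    (h : GlobalDimensionLE.{u, v} R n) : GlobalDimensionLE.{u, v} (Polynomial R) (n + 1) := by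
  intro N _ _
  let _ : Module R N := Module.compHom N (algebraMap R (Polynomial R))
  have : IsScalarTower R (Polynomial R) N := .of_algebraMap_smul fun _ _ => rfl
  have hT := hasProjectiveDimensionLE_baseChange.{u, v} (S := Polynomial R) (h N)
  refine hasProjectiveDimensionLE_of_exact polynomialDiff_injective polynomialDiff_exact
    (fun y => ⟨1 ⊗ₜ[R] y, by rw [liftBaseChange_id_tmul, one_smul]⟩) hT ?_
  exact CategoryTheory.hasProjectiveDimensionLT_of_ge _ (n + 1) _ (by omega)

theorem globalDimensionLE_field (k : Type u) [Field k] : GlobalDimensionLE.{u, v} k 0 := by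
  intro M _ _
  rw [hasProjectiveDimensionLE_zero_iff]
  infer_instance

/-- **Hilbert's syzygy theorem**, as a bound on the global dimension. -/
theorem globalDimensionLE_mvPolynomial (k : Type u) [Field k] (n : ℕ) :
    GlobalDimensionLE.{u, v} (MvPolynomial (Fin n) k) n := by
  induction n with
  | zero =>
    exact GlobalDimensionLE.of_ringEquiv.{u, v} (MvPolynomial.isEmptyRingEquiv k (Fin 0)).symm
      (globalDimensionLE_field k)
  | succ n ih =>
    exact GlobalDimensionLE.of_ringEquiv.{u, v} (MvPolynomial.finSuccEquiv k n).symm.toRingEquiv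
      ih.polynomial

/-- If `⋯ → P → P → P → ⋯` is an exact sequence of projective modules with alternating maps `f`,
`g` over a ring of finite global dimension, then the kernel of `f` is projective. -/
theorem projective_ker_of_exact {R : Type u} [Ring R] {P : Type (max u v)} [AddCommGroup P]
    [Module R P] [Module.Projective R P] {f g : P →ₗ[R] P} (hfg : Function.Exact f g)
    (hgf : Function.Exact g f) {n : ℕ} (hR : GlobalDimensionLE.{u, v} R n) :
    Module.Projective R (LinearMap.ker f) := by
  -- By exactness `0 → ker f → P → ker g → 0` is exact, so passing from one kernel to the other
  -- lowers the dimension bound by one.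
  have step {f g : P →ₗ[R] P} (hfg : Function.Exact f g) (m : ℕ)
      (h : CategoryTheory.HasProjectiveDimensionLE (ModuleCat.of R (LinearMap.ker g)) (m + 1)) :
      CategoryTheory.HasProjectiveDimensionLE (ModuleCat.of R (LinearMap.ker f)) m := by
    have hs : Function.Surjective (f.codRestrict (LinearMap.ker g) hfg.apply_apply_eq_zero) := by
      rintro ⟨y, hy⟩
      obtain ⟨x, rfl⟩ := (hfg y).mp hy
      exact ⟨x, rfl⟩
    exact hasProjectiveDimensionLE_congr (LinearEquiv.ofEq _ _ (LinearMap.ker_codRestrict _ _ _))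
      (hasProjectiveDimensionLE_ker hs h)
  have key (m : ℕ) :
      CategoryTheory.HasProjectiveDimensionLE (ModuleCat.of R (LinearMap.ker f)) m →
      CategoryTheory.HasProjectiveDimensionLE (ModuleCat.of R (LinearMap.ker g)) m →
      CategoryTheory.HasProjectiveDimensionLE (ModuleCat.of R (LinearMap.ker f)) 0 := by
    induction m with
    | zero => exact fun h _ => h
    | succ m ih => exact fun h₁ h₂ => ih (step hfg m h₂) (step hgf m h₁)
  exact hasProjectiveDimensionLE_zero_iff.mp (key n (hR _) (hR _))

/-! ### Contractible `N`-differential modules -/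

section NDifferential

variable {R : Type*} [Ring R] {P : Type*} [AddCommGroup P] [Module R P]

/-- The isomorphism is `c ↦ ∑ d ^ (q - j) (σ (c j))`: applying `d` lowers the index of each summand
by one and kills the summand `j = 0`. -/
theorem isContractibleNDifferential_of_section {q : ℕ} {d : P →ₗ[R] P} (hd : d ^ (q + 1) = 0)
    (σ : LinearMap.ker d →ₗ[R] P) (hσ : ∀ c, (d ^ q) (σ c) = c) :
    IsContractibleNDifferential (q + 1) d := by
  have hd' {j : ℕ} (hj : q < j) (x : P) : (d ^ j) x = 0 := by
    rw [pow_eq_zero_of_le hj hd, LinearMap.zero_apply]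
  let φ : (Fin (q + 1) → LinearMap.ker d) →ₗ[R] P :=
    ∑ j : Fin (q + 1), (d ^ (q - j)) ∘ₗ σ ∘ₗ LinearMap.proj j
  have hφ (c) : φ c = ∑ j : Fin (q + 1), (d ^ (q - (j : ℕ))) (σ (c j)) := by
    simp [φ, LinearMap.sum_apply]
  have hinj : Function.Injective φ := by
    rw [injective_iff_map_eq_zero]
    intro c hc
    -- Descending induction on `j`: `d ^ j` kills the summands of index below `j`, those above are
    -- already zero, and summand `j` becomes `c j`.
    have h (t : ℕ) : ∀ j : Fin (q + 1), q ≤ j + t → c j = 0 := by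
      induction t using Nat.strong_induction_on with
      | _ t ih =>
        intro j hj
        have h1 : (d ^ (j : ℕ)) (φ c) = c j := by
          rw [hφ, map_sum, Finset.sum_eq_single j]
          · rw [← Module.End.mul_apply, ← pow_add, Nat.add_sub_cancel' (by omega), hσ]
          · intro i _ hij
            rw [← Module.End.mul_apply, ← pow_add]
            rcases lt_or_gt_of_ne hij with h | h
            · exact hd' (by have : (i : ℕ) < j := h; omega) _
            · have : (j : ℕ) < i := h
              rw [ih (q - i) (by omega) i (by omega), map_zero, map_zero]
          · simp
        rw [hc, map_zero] at h1
        exact Subtype.ext h1.symm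
    exact funext fun j => h q j (by omega)
  have hsurj : Function.Surjective φ := by
    -- Induction along the filtration by `ker (d ^ s)`: subtracting `d ^ (q - s) (σ (d ^ s x))`
    -- moves `x` from step `s + 1` into step `s`.
    have h (s : ℕ) : s ≤ q + 1 → ∀ x, (d ^ s) x = 0 → x ∈ LinearMap.range φ := by
      induction s with
      | zero => exact fun _ x hx => by simp_all
      | succ s ih =>
        intro hs x hx
        let c : LinearMap.ker d := ⟨(d ^ s) x, by
          rwa [LinearMap.mem_ker, ← Module.End.mul_apply, ← pow_succ']⟩
        have hy : φ (Pi.single ⟨s, hs⟩ c) = (d ^ (q - s)) (σ c) := by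
          rw [hφ, Finset.sum_eq_single ⟨s, hs⟩]
          · simp
          · intro i _ hi
            rw [Pi.single_eq_of_ne hi, map_zero, map_zero]
          · simp
        have hxy : x - φ (Pi.single ⟨s, hs⟩ c) ∈ LinearMap.range φ := by
          refine ih (by omega) _ ?_
          rw [hy, map_sub, ← Module.End.mul_apply, ← pow_add, Nat.add_sub_cancel' (by omega), hσ,
            sub_self]
        simpa using add_mem hxy (LinearMap.mem_range_self φ (Pi.single ⟨s, hs⟩ c))
    exact fun x => h (q + 1) le_rfl x (hd' (by omega) x)
  let e := LinearEquiv.ofBijective φ ⟨hinj, hsurj⟩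
  have hde (c : Fin (q + 1) → LinearMap.ker d) : d (φ c) =
      φ fun i => if h : (i : ℕ) + 1 < q + 1 then c ⟨i + 1, h⟩ else 0 := by
    rw [hφ, hφ, map_sum, Fin.sum_univ_succ, Fin.sum_univ_castSucc]
    rw [add_comm]
    congr 1
    · refine Finset.sum_congr rfl fun i _ => ?_
      rw [← Module.End.mul_apply, ← pow_succ', dif_pos (by simp),
        show q - (i.succ : ℕ) + 1 = q - (i.castSucc : ℕ) by simp; omega]
      rfl
    · rw [← Module.End.mul_apply, ← pow_succ', hd' (by simp), dif_neg (by simp), map_zero, map_zero]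
  refine ⟨LinearMap.ker d, inferInstance, inferInstance, e.symm, fun x i => ?_⟩
  obtain ⟨c, rfl⟩ := e.surjective x
  have : d (e c) = e _ := hde c
  rw [this, e.symm_apply_apply, e.symm_apply_apply]

/-- Since `d` shifts coordinates one way, take `a` and `b` to be the opposite shifts by `N - s` and
`s`; the two terms restore the coordinates below `s` and from `s` on. -/
theorem IsContractibleNDifferential.exists_eq_add {N : ℕ} {d : P →ₗ[R] P}
    (h : IsContractibleNDifferential N d) {s : ℕ} (hs : s ≤ N) :
    ∃ a b : P →ₗ[R] P, ∀ x, x = (d ^ (N - s)) (a x) + b ((d ^ s) x) := by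
  obtain ⟨C, _, _, e, he⟩ := h
  have hpow (t : ℕ) (x : P) (i : Fin N) :
      e ((d ^ t) x) i = if h : (i : ℕ) + t < N then e x ⟨i + t, h⟩ else 0 := by
    induction t generalizing x with
    | zero => simp
    | succ t ih =>
      rw [pow_succ, Module.End.mul_apply, ih]
      split_ifs with h1 h2 h2
      · simp only [he, add_assoc, dif_pos h2]
      · simp only [he, add_assoc, dif_neg h2]
      · omega
      · rfl
  let r (t : ℕ) : P →ₗ[R] P := e.symm.toLinearMap ∘ₗ (LinearMap.pi fun i : Fin N =>
    if t ≤ i then LinearMap.proj ⟨i - t, by omega⟩ else 0) ∘ₗ e.toLinearMap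
  have hr (t : ℕ) (x : P) (i : Fin N) :
      e (r t x) i = if t ≤ i then e x ⟨i - t, by omega⟩ else 0 := by
    simp only [r, LinearMap.comp_apply, LinearEquiv.coe_coe, LinearEquiv.apply_symm_apply,
      LinearMap.pi_apply]
    split_ifs <;> rfl
  refine ⟨r (N - s), r s, fun x => e.injective (funext fun i => ?_)⟩
  rw [map_add, Pi.add_apply, hpow, hr, hpow]
  by_cases h : s ≤ i
  · rw [dif_neg (by omega), if_pos h, dif_pos (by simp; omega), zero_add]
    simp only [Nat.sub_add_cancel h]
  · rw [dif_pos (by omega), if_neg h, hr, if_pos (by simp), add_zero]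
    simp only [Nat.add_sub_cancel]

end NDifferential

/-! ### Nilpotence of homogeneous operators on finite-dimensional homology -/

section Graded

variable {k M : Type*} [Field k] [AddCommGroup M] [Module k M] {gr : ℤ → Submodule k M}

theorem decompose_apply_of_shift [DirectSum.Decomposition gr] {T : M →+ M} {e : ℤ}
    (hT : ∀ i x, x ∈ gr i → T x ∈ gr (i + e)) (x : M) (i : ℤ) :
    (DirectSum.decompose gr (T x) (i + e) : M) = T (DirectSum.decompose gr x i) := by
  induction x using DirectSum.Decomposition.inductionOn gr with
  | zero => simp
  | @homogeneous j y =>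
    by_cases h : j = i
    · subst h
      rw [DirectSum.decompose_of_mem_same _ (hT _ _ y.2), DirectSum.decompose_of_mem_same _ y.2]
    · rw [DirectSum.decompose_of_mem_ne _ (hT _ _ y.2) (by simpa using h),
        DirectSum.decompose_of_mem_ne _ y.2 h, map_zero]
  | add a b ha hb => simp [ha, hb]

theorem shift_pow {T : Module.End k M} {e : ℤ} (hT : ∀ i x, x ∈ gr i → T x ∈ gr (i + e))
    (t : ℕ) (i : ℤ) (x : M) (hx : x ∈ gr i) : (T ^ t) x ∈ gr (i + t * e) := by
  induction t with
  | zero => simpa using hx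
  | succ t ih =>
    rw [pow_succ', Module.End.mul_apply]
    convert hT _ _ ih using 2
    push_cast
    ring

/-- A homogeneous operator of nonzero degree on a graded space acts nilpotently on any
finite-dimensional quotient `ker f / (ker f ∩ range g)`, where `f` and `g` are homogeneous operators
commuting with it. -/
theorem exists_pow_mem_range_of_finiteDimensional (hgr : DirectSum.IsInternal gr)
    {T f g : Module.End k M} {e a b : ℤ} (he : e ≠ 0)
    (hT : ∀ i x, x ∈ gr i → T x ∈ gr (i + e)) (hf : ∀ i x, x ∈ gr i → f x ∈ gr (i + a))
    (hg : ∀ i x, x ∈ gr i → g x ∈ gr (i + b)) (hTf : Commute T f) (hTg : Commute T g)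
    (hfin : FiniteDimensional k (LinearMap.ker f ⧸ (LinearMap.range g).submoduleOf
      (LinearMap.ker f))) :
    ∃ D : ℕ, ∀ x ∈ LinearMap.ker f, (T ^ D) x ∈ LinearMap.range g := by
  classical
  let _ := hgr.chooseDecomposition
  have hTk (x) (hx : x ∈ LinearMap.ker f) : T x ∈ LinearMap.ker f := by
    rw [LinearMap.mem_ker] at hx ⊢
    rw [← Module.End.mul_apply, ← hTf.eq, Module.End.mul_apply, hx, map_zero]
  let W := (LinearMap.range g).submoduleOf (LinearMap.ker f)
  let T₀ : Module.End k (LinearMap.ker f) := T.restrict hTk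
  have hW : W ≤ W.comap T₀ := by
    rintro x ⟨y, hy⟩
    refine ⟨T y, ?_⟩
    rw [← Module.End.mul_apply, ← hTg.eq, Module.End.mul_apply, hy]
    rfl
  let T₁ : Module.End k (LinearMap.ker f ⧸ W) := W.mapQ W T₀ hW
  let q := LinearMap.charpoly T₁
  have hpow (t : ℕ) (x : LinearMap.ker f) :
      (T₁ ^ t) (W.mkQ x) = W.mkQ ((T₀ ^ t) x) ∧ ((T₀ ^ t) x : M) = (T ^ t) x := by
    induction t with
    | zero => simp
    | succ t ih =>
      simp only [pow_succ', Module.End.mul_apply, ih.1]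
      refine ⟨rfl, ?_⟩
      rw [← ih.2]
      rfl
  -- Cayley–Hamilton for the induced operator on the quotient.
  have hq (x) (hx : x ∈ LinearMap.ker f) : Polynomial.aeval T q x ∈ LinearMap.range g := by
    have h0 : Polynomial.aeval T₁ q (W.mkQ ⟨x, hx⟩) = 0 := by
      rw [LinearMap.aeval_self_charpoly, LinearMap.zero_apply]
    have h1 : Polynomial.aeval T₁ q (W.mkQ ⟨x, hx⟩) =
        W.mkQ (∑ i ∈ Finset.range (q.natDegree + 1), q.coeff i • (T₀ ^ i) ⟨x, hx⟩) := by
      rw [Polynomial.aeval_eq_sum_range, LinearMap.sum_apply, map_sum]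
      refine Finset.sum_congr rfl fun i _ => ?_
      rw [LinearMap.smul_apply, (hpow _ _).1, map_smul]
    rw [h0, eq_comm, Submodule.mkQ_apply, Submodule.Quotient.mk_eq_zero] at h1
    have h2 : ((∑ i ∈ Finset.range (q.natDegree + 1), q.coeff i • (T₀ ^ i) ⟨x, hx⟩ :
      LinearMap.ker f) : M) ∈ LinearMap.range g := h1
    convert h2
    rw [Polynomial.aeval_eq_sum_range, LinearMap.sum_apply, AddSubmonoidClass.coe_finsetSum]
    refine Finset.sum_congr rfl fun i _ => ?_
    rw [LinearMap.smul_apply, Submodule.coe_smul, (hpow _ _).2]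
  refine ⟨q.natDegree, ?_⟩
  -- As `e ≠ 0`, the terms of `q(T) x` lie in distinct degrees; as `g` is homogeneous, the top term
  -- alone is in its range, and `q` is monic.
  have hhom (i : ℤ) (x) (hxi : x ∈ gr i) (hx : x ∈ LinearMap.ker f) :
      (T ^ q.natDegree) x ∈ LinearMap.range g := by
    obtain ⟨y, hy⟩ := hq x hx
    have h1 := decompose_apply_of_shift (T := g.toAddMonoidHom) hg y (i + q.natDegree * e - b)
    rw [sub_add_cancel] at h1
    refine ⟨_, h1.symm.trans ?_⟩
    change (DirectSum.decompose gr (g y) (i + q.natDegree * e) : M) = _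
    rw [hy, Polynomial.aeval_eq_sum_range, LinearMap.sum_apply, DirectSum.decompose_sum,
      DirectSum.sum_apply, AddSubmonoidClass.coe_finsetSum, Finset.sum_eq_single q.natDegree]
    · rw [Polynomial.coeff_natDegree, (LinearMap.charpoly_monic T₁).leadingCoeff, one_smul,
        DirectSum.decompose_of_mem_same _ (shift_pow hT _ _ _ hxi)]
    · intro j _ hj
      refine DirectSum.decompose_of_mem_ne _ (Submodule.smul_mem _ _ (shift_pow hT j i x hxi)) ?_
      simpa [he] using hj
    · simp
  intro x hx
  rw [← DirectSum.sum_support_decompose gr x, map_sum]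
  refine Submodule.sum_mem _ fun i _ => hhom i _ (SetLike.coe_mem _) ?_
  have h1 := decompose_apply_of_shift (T := f.toAddMonoidHom) hf x i
  rw [LinearMap.mem_ker]
  refine h1.symm.trans ?_
  change (DirectSum.decompose gr (f x) (i + a) : M) = 0
  rw [LinearMap.mem_ker.mp hx]
  simp

end Graded

/-! ### Vanishing of homology after localization -/

theorem baseChange_pow_apply_tmul {A : Type*} [CommRing A] {M : Type*} [AddCommGroup M] [Module A M]
    (S : Type*) [CommRing S] [Algebra A S] (d : M →ₗ[A] M) (t : ℕ) (a : S) (x : M) :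
    ((d.baseChange S) ^ t) (a ⊗ₜ x) = a ⊗ₜ (d ^ t) x := by
  rw [← LinearMap.baseChange_pow, LinearMap.baseChange_tmul]

/-- If `c` annihilates `ker f / (ker f ∩ range g)`, this quotient vanishes after any localization
in which `c` is inverted. -/
theorem ker_baseChange_le_range_of_smul_mem {A : Type*} [CommRing A] {M : Type*} [AddCommGroup M]
    [Module A M] {f g : M →ₗ[A] M} (W : Submonoid A) (S : Type*) [CommRing S] [Algebra A S]
    [IsLocalization W S] {c : A} (hc : c ∈ W) (h : ∀ x, f x = 0 → c • x ∈ LinearMap.range g) :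
    LinearMap.ker (f.baseChange S) ≤ LinearMap.range (g.baseChange S) := by
  intro z hz
  obtain ⟨⟨x, w⟩, hw⟩ := IsLocalizedModule.surj W (TensorProduct.mk A S M 1) z
  have h1 : TensorProduct.mk A S M 1 (f x) = TensorProduct.mk A S M 1 0 := by
    have : (f.baseChange S) (w • z) = 0 := by
      rw [Submonoid.smul_def, ← algebraMap_smul S, map_smul, LinearMap.mem_ker.mp hz, smul_zero]
    rw [hw] at this
    simpa using this
  obtain ⟨t, ht⟩ := IsLocalizedModule.exists_of_eq (S := W) h1
  obtain ⟨y, hy⟩ := h ((t : A) • x) (by rwa [map_smul, ← Submonoid.smul_def, ← smul_zero t])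
  have hu : IsUnit (algebraMap A S (c * t * w)) :=
    IsLocalization.map_units S (⟨c * t * w, W.mul_mem (W.mul_mem hc t.2) w.2⟩ : W)
  have hz' : (algebraMap A S (c * t * w)) • z = (g.baseChange S) (1 ⊗ₜ y) := by
    rw [LinearMap.baseChange_tmul, hy, algebraMap_smul, mul_smul, mul_smul,
      ← Submonoid.smul_def w, hw]
    simp
  obtain ⟨u, hu⟩ := hu
  refine ⟨(↑u⁻¹ : S) • (1 ⊗ₜ y), ?_⟩
  rw [map_smul, ← hz', ← hu, smul_smul, Units.inv_mul, one_smul]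

namespace PDGModule

variable {k : Type u} [Field k] {n p : ℕ} {M : Type v} [AddCommGroup M] [Module k M]
  [Module (MvPolynomial (Fin n) k) M] [IsScalarTower k (MvPolynomial (Fin n) k) M]
  (D : PDGModule k n p M)

theorem d_pow_mem (s : ℕ) (i : ℤ) (x : M) (hx : x ∈ D.gr i) : (D.d ^ s) x ∈ D.gr (i + -s) := by
  induction s with
  | zero => simpa using hx
  | succ s ih =>
    rw [pow_succ', Module.End.mul_apply]
    convert D.d_mem _ _ ih using 2
    push_cast
    ring

theorem X_smul_mem (j : Fin n) (i : ℤ) (x : M) (hx : x ∈ D.gr i) :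
    (MvPolynomial.X j : MvPolynomial (Fin n) k) • x ∈ D.gr (i + -1) := by
  rw [add_comm]
  exact D.smul_mem (-1) i _ x (MvPolynomial.isWeightedHomogeneous_X k _ j) hx

theorem exists_X_pow_smul_mem_range {s : ℕ} (hfin : FiniteDimensional k (NHomology p s D.d))
    (j : Fin n) : ∃ N : ℕ, ∀ x, (D.d ^ s) x = 0 →
      (MvPolynomial.X j : MvPolynomial (Fin n) k) ^ N • x ∈ LinearMap.range (D.d ^ (p - s)) := by
  let T : Module.End k M := Algebra.lsmul k k M (MvPolynomial.X j : MvPolynomial (Fin n) k)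
  have hT (f : M →ₗ[MvPolynomial (Fin n) k] M) : Commute T (f.restrictScalars k) :=
    LinearMap.ext fun x => (f.map_smul _ x).symm
  have hfin' := Module.Finite.equiv (Submodule.Quotient.restrictScalarsEquiv k
    ((LinearMap.range (D.d ^ (p - s))).submoduleOf (LinearMap.ker (D.d ^ s)))).symm
  obtain ⟨N, hN⟩ := exists_pow_mem_range_of_finiteDimensional D.isInternal (T := T)
    (f := (D.d ^ s).restrictScalars k) (g := (D.d ^ (p - s)).restrictScalars k) (e := -1)
    (by simp) (D.X_smul_mem j) (D.d_pow_mem s) (D.d_pow_mem (p - s)) (hT _) (hT _) hfin'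
  refine ⟨N, fun x hx => ?_⟩
  have := hN x hx
  rwa [← map_pow] at this

theorem ker_baseChange_pow_le_range {s : ℕ} (hfin : FiniteDimensional k (NHomology p s D.d))
    (m : Ideal (MvPolynomial (Fin n) k)) [m.IsPrime] {j : Fin n} (hj : MvPolynomial.X j ∉ m) :
    LinearMap.ker (D.d.baseChange (Localization.AtPrime m) ^ s) ≤
      LinearMap.range (D.d.baseChange (Localization.AtPrime m) ^ (p - s)) := by
  obtain ⟨N, hN⟩ := D.exists_X_pow_smul_mem_range hfin j
  rw [← LinearMap.baseChange_pow, ← LinearMap.baseChange_pow]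
  exact ker_baseChange_le_range_of_smul_mem m.primeCompl (Localization.AtPrime m)
    (m.primeCompl.pow_mem hj N) hN

end PDGModule

/-- If `m` contained every variable, it would contain the constant term of each of its elements;
being proper, it would be the ideal of the variables. -/
theorem exists_X_notMem {k : Type*} [Field k] {n : ℕ} {m : Ideal (MvPolynomial (Fin n) k)}
    (hm : m ≠ ⊤)
    (hne : m ≠ Ideal.span (Set.range (MvPolynomial.X : Fin n → MvPolynomial (Fin n) k))) :
    ∃ j, (MvPolynomial.X j : MvPolynomial (Fin n) k) ∉ m := by
  by_contra! h
  have hle : Ideal.span (Set.range (MvPolynomial.X : Fin n → MvPolynomial (Fin n) k)) ≤ m :=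
    Ideal.span_le.mpr (Set.range_subset_iff.mpr h)
  refine hne (le_antisymm (fun f hf => ?_) hle)
  have hsub : f - MvPolynomial.C (f.coeff 0) ∈ MvPolynomial.idealOfVars (Fin n) k := by
    rw [← pow_one (MvPolynomial.idealOfVars (Fin n) k), MvPolynomial.mem_pow_idealOfVars_iff']
    intro x hx
    rw [Nat.lt_one_iff, Finsupp.degree_eq_zero_iff] at hx
    simp [hx]
  have hC : MvPolynomial.C (f.coeff 0) ∈ m := by
    simpa using sub_mem hf (hle hsub)
  have h0 : f.coeff 0 = 0 := by
    by_contra h0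
    exact hm (Ideal.eq_top_of_isUnit_mem _ hC ((isUnit_iff_ne_zero.mpr h0).map MvPolynomial.C))
  rwa [h0, map_zero, sub_zero] at hsub

/-! ### Contractibility at `m` and reduction modulo `m` -/

/-- An `N`-differential projective module over a ring of
finite global dimension is contractible once its first and last homologies vanish. -/
theorem isContractibleNDifferential_of_exact {R : Type u} [Ring R] {P : Type (max u v)}
    [AddCommGroup P] [Module R P] [Module.Projective R P] {n q : ℕ}
    (hR : GlobalDimensionLE.{u, v} R n) {d : P →ₗ[R] P} (hd : d ^ (q + 1) = 0)
    (h₁ : LinearMap.ker d ≤ LinearMap.range (d ^ q))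
    (h₂ : LinearMap.ker (d ^ q) ≤ LinearMap.range d) :
    IsContractibleNDifferential (q + 1) d := by
  have e₁ : Function.Exact d (d ^ q) := fun x => ⟨fun h => h₂ h, by
    rintro ⟨y, rfl⟩
    rw [← Module.End.mul_apply, ← pow_succ, hd, LinearMap.zero_apply]⟩
  have e₂ : Function.Exact (d ^ q) d := fun x => ⟨fun h => h₁ h, by
    rintro ⟨y, rfl⟩
    rw [← Module.End.mul_apply, ← pow_succ', hd, LinearMap.zero_apply]⟩
  have := projective_ker_of_exact e₁ e₂ hR
  obtain ⟨σ, hσ⟩ := Module.projective_lifting_property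
    ((d ^ q).codRestrict (LinearMap.ker d) e₂.apply_apply_eq_zero) LinearMap.id (by
      rintro ⟨x, hx⟩
      obtain ⟨y, rfl⟩ := h₁ hx
      exact ⟨y, rfl⟩)
  exact isContractibleNDifferential_of_section hd σ
    fun c => congrArg Subtype.val (LinearMap.congr_fun hσ c)

/-- If the localization of an `N`-differential module at a maximal ideal `m` is contractible, the
homology of its reduction modulo `m` vanishes. -/
theorem subsingleton_NHomology_baseChange_quotient {A : Type*} [CommRing A] {M : Type*}
    [AddCommGroup M] [Module A M] {N s : ℕ} (hs : s ≤ N) {d : M →ₗ[A] M} (m : Ideal A)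
    [m.IsMaximal] (h : IsContractibleNDifferential N (d.baseChange (Localization.AtPrime m))) :
    Subsingleton (NHomology N s (d.baseChange (A ⧸ m))) := by
  obtain ⟨a, b, hab⟩ := h.exists_eq_add hs
  let _ := Ideal.Quotient.field m
  let φ : Localization.AtPrime m →ₐ[A] A ⧸ m := IsLocalization.liftAlgHom (M := m.primeCompl)
    (f := Ideal.Quotient.mkₐ A m) fun y => by
      rw [isUnit_iff_ne_zero]
      exact fun h => y.2 (Ideal.Quotient.eq_zero_iff_mem.mp h)
  let π : Localization.AtPrime m ⊗[A] M →ₗ[A] (A ⧸ m) ⊗[A] M := φ.toLinearMap.rTensor M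
  have hπ (t : ℕ) (z) : π ((d.baseChange (Localization.AtPrime m) ^ t) z) =
      (d.baseChange (A ⧸ m) ^ t) (π z) := by
    induction z with
    | zero => simp
    | add x y hx hy => simp only [map_add, hx, hy]
    | tmul r x => simp [π, baseChange_pow_apply_tmul]
  -- By linearity `b` preserves multiples of `m`, which `π` kills.
  have hsm : ∀ z ∈ m • (⊤ : Submodule A (Localization.AtPrime m ⊗[A] M)),
      π (b z) = 0 := by
    intro z hz
    refine Submodule.smul_induction_on hz (fun r hr x _ => ?_) fun x y hx hy => ?_
    · rw [← algebraMap_smul (Localization.AtPrime m), map_smul, algebraMap_smul, map_smul,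
        ← algebraMap_smul (A ⧸ m), Ideal.Quotient.algebraMap_eq,
        Ideal.Quotient.eq_zero_iff_mem.mpr hr, zero_smul]
    · rw [map_add, map_add, hx, hy, add_zero]
  refine Submodule.Quotient.subsingleton_iff.mpr (eq_top_iff.mpr ?_)
  rintro ⟨z, hz⟩ -
  -- A cycle modulo `m` lifts to `x` in `M` with `d ^ s x ∈ m M`, so the term in `b` vanishes under
  -- `π` and the homotopy exhibits the cycle as a boundary.
  obtain ⟨x, rfl⟩ := TensorProduct.mk_surjective A M (A ⧸ m) Ideal.Quotient.mk_surjective z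
  have hx : (d ^ s) x ∈ m • (⊤ : Submodule A M) := by
    have : (1 : A ⧸ m) ⊗ₜ[A] (d ^ s) x = 0 := by
      rw [← baseChange_pow_apply_tmul]
      exact hz
    rwa [← LinearMap.ker_tensorProductMk]
  have hx' : (1 : Localization.AtPrime m) ⊗ₜ[A] (d ^ s) x ∈
      m • (⊤ : Submodule A (Localization.AtPrime m ⊗[A] M)) := by
    have := Submodule.mem_map_of_mem (f := TensorProduct.mk A (Localization.AtPrime m) M 1) hx
    rw [Submodule.map_smul''] at this
    exact Submodule.smul_mono le_rfl le_top this
  have h1 := congrArg π (hab (1 ⊗ₜ x))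
  rw [map_add, hπ, baseChange_pow_apply_tmul, hsm _ hx', add_zero] at h1
  exact ⟨π (a (1 ⊗ₜ x)), h1.symm.trans (by simp [π])⟩

theorem proposition5p4 (p : ℕ) [Fact p.Prime] (k : Type u) [Field k] [CharP k p] (n : ℕ)
    (M : Type v) [AddCommGroup M] [Module k M] [Module (MvPolynomial (Fin n) k) M]
    [IsScalarTower k (MvPolynomial (Fin n) k) M]
    (D : PDGModule k n p M) (hfree : D.IsFree)
    (hfg : Module.Finite (MvPolynomial (Fin n) k) M)
    (hfin : ∀ s : ℕ, 1 ≤ s → s ≤ p - 1 → FiniteDimensional k (NHomology p s D.d))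
    (m : Ideal (MvPolynomial (Fin n) k)) [hm : m.IsMaximal]
    (hne : m ≠ Ideal.span (Set.range (MvPolynomial.X : Fin n → MvPolynomial (Fin n) k))) :
    (∀ s : ℕ, 1 ≤ s → s ≤ p - 1 →
      Subsingleton (NHomology p s (D.d.baseChange (MvPolynomial (Fin n) k ⧸ m)))) ∧
    IsContractibleNDifferential (P := Localization.AtPrime m ⊗[MvPolynomial (Fin n) k] M) p
      (D.d.baseChange (Localization.AtPrime m)) := by
  obtain ⟨ι, b, -⟩ := hfree
  have : Module.Free (MvPolynomial (Fin n) k) M := .of_basis b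
  obtain ⟨j, hj⟩ := exists_X_notMem hm.ne_top hne
  have hp : 2 ≤ p := (Fact.out : p.Prime).two_le
  obtain ⟨q, rfl⟩ : ∃ q, p = q + 1 := ⟨p - 1, by omega⟩
  have h : IsContractibleNDifferential
      (P := Localization.AtPrime m ⊗[MvPolynomial (Fin n) k] M) (q + 1)
      (D.d.baseChange (Localization.AtPrime m)) := by
    refine isContractibleNDifferential_of_exact.{u, v}
      ((globalDimensionLE_mvPolynomial k n).isLocalization m.primeCompl) ?_ ?_ ?_
    · rw [← LinearMap.baseChange_pow, D.d_pow, LinearMap.baseChange_zero]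
    · simpa using D.ker_baseChange_pow_le_range (hfin 1 le_rfl (by omega)) m hj
    · simpa using D.ker_baseChange_pow_le_range (hfin q (by omega) (by omega)) m hj
  exact ⟨fun s _ hs => subsingleton_NHomology_baseChange_quotient (by omega) m h, h⟩
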